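/- **Proposition.** Let $N\ge 1$ and let $K^{(1)},\dots,K^{(N)}$ be block sizes, with $L=\sum_{i=1}^N K^{(i)}$ and $K=\max_i K^{(i)}\ge 2$. For an $L\times L$ matrix $M$ write $M^{(i,i)}\in\mathbb{R}^{K^{(i)}\times K^{(i)}}$ for its $i$-th diagonal block. Let $\beta>0$, let $A\in\mathbb{R}^{L\times L}$ be a symmetric cost matrix and let $\Lambda^{(i)}\in\mathbb{R}^{K^{(i)}\times K^{(i)}}$, $i=1,\dots,N$, be symmetric. Put $$X=\exp\Big(-\beta\Big(A-\bigoplus_{i=1}^N\Lambda^{(i)}\Big)\Big),\qquad \hat X=\frac1S\,X^{1/2}ZZ^\top X^{1/2},$$ where $Z\in\mathbb{R}^{L\times S}$ has i.i.d. standard Gaussian entries. For every $\delta_0\in(0,1)$ there is a constant $C>0$, depending only on $\delta_0$, such that the following holds for all such data and all $\varepsilon,\delta\in(0,1)$ with $N\ge 2$ or $\delta\le\delta_0$. (In particular, for $N\ge2$ the constant can be taken absolute.) If $$S\ \ge\ \frac{C\,\log(N/\delta)}{\varepsilon^2}\,K\log K,$$ then with probability at least $1-\delta$, simultaneously for all $i=1,\dots,N$,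 $$(1-\varepsilon)\,X^{(i,i)}\preceq \hat X^{(i,i)}\preceq(1+\varepsilon)\,X^{(i,i)}\qquad\text{and}\qquad \big\|\log\hat X^{(i,i)}-\log X^{(i,i)}\big\|\le|\log(1-\varepsilon)|,$$ where $\preceq$ is the Loewner order, $\log$ of a positive definite matrix is the matrix logarithm, and $\|\cdot\|$ is the spectral norm. Moreover, for every realization of $Z$ and every $i$, the first pair of inequalities implies the logarithm bound. -/

import Mathlib

open MeasureTheory ProbabilityTheory
open scoped Matrix MatrixOrder Matrix.Norms.L2Operator

namespace BlockSketch

/-- Row and column indices of the large matrices: pairs `(i, k)` of a block `i` and a position `k`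
in that block. There are `L = ∑ i, K i` of them. -/
abbrev Idx {N : ℕ} (K : Fin N → ℕ) : Type := (i : Fin N) × Fin (K i)

/-- The largest block size, `max_i K i`. -/
def maxBlock {N : ℕ} (K : Fin N → ℕ) : ℕ := Finset.univ.sup K

noncomputable section

/-- The effective cost matrix `C - ⨁ i, Λ i`. -/
def effCost {N : ℕ} {K : Fin N → ℕ} (cost : Matrix (Idx K) (Idx K) ℝ)
    (Lam : (i : Fin N) → Matrix (Fin (K i)) (Fin (K i)) ℝ) : Matrix (Idx K) (Idx K) ℝ :=
  cost - Matrix.blockDiagonal' Lam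

/-- The primal matrix `X = exp (-β (C - ⨁ i, Λ i))`. -/
def primal {N : ℕ} {K : Fin N → ℕ} (β : ℝ) (cost : Matrix (Idx K) (Idx K) ℝ)
    (Lam : (i : Fin N) → Matrix (Fin (K i)) (Fin (K i)) ℝ) : Matrix (Idx K) (Idx K) ℝ :=
  NormedSpace.exp (-β • effCost cost Lam)

/-- The sketched estimator `X^{1/2} Z Zᵀ X^{1/2} / S`, where `X^{1/2}` is the positive
semidefinite square root. -/
def sketch {N : ℕ} {K : Fin N → ℕ} {S : ℕ} (X : Matrix (Idx K) (Idx K) ℝ)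
    (Z : Matrix (Idx K) (Fin S) ℝ) : Matrix (Idx K) (Idx K) ℝ :=
  (1 / (S : ℝ)) • (CFC.sqrt X * Z * Zᵀ * CFC.sqrt X)

/-- `Z` is a random matrix with i.i.d. standard Gaussian entries. -/
structure IsGaussianSketch {Ω : Type*} [MeasurableSpace Ω] {m n : Type*}
    (Z : Ω → Matrix m n ℝ) (μ : Measure Ω) : Prop where
  hasLaw : ∀ k s, HasLaw (fun ω => Z ω k s) (gaussianReal 0 1) μ
  indep : iIndepFun (fun (p : m × n) ω => Z ω p.1 p.2) μ

/-- `(1 - ε) A ⪯ B ⪯ (1 + ε) A` in the Loewner order. -/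
def RelClose {n : Type*} [Fintype n] (ε : ℝ) (A B : Matrix n n ℝ) : Prop :=
  (1 - ε) • A ≤ B ∧ B ≤ (1 + ε) • A

end

end BlockSketch

/-!
The diagonal blocks of `X` and of its sketch are the Gram matrices of `W` and `S^{-1/2} Zᵀ W`, where
`W` consists of the columns of `X^{1/2}` belonging to the block. So the Loewner inequalities say
that `S^{-1/2} Zᵀ` preserves squared norms up to a factor `1 ± ε` on the range of `W`, a subspace
whose dimension `d` is at most the size of the block, however large `X` is. For a fixed unit vector
`a` the quantity `‖Zᵀ a‖²` is chi-squared with `S` degrees of freedom and concentrates around `S`;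
a `1/2`-net of the unit sphere of the subspace, with at most `5 ^ d` points, upgrades this to all
vectors, and a union bound runs over the blocks. The logarithm bound then follows from the operator
monotonicity of the logarithm.
-/

namespace BlockSketch

section Gaussian

variable {Ω : Type*} [MeasurableSpace Ω] {μ : Measure Ω}

lemma iIndepFun_curry {ι κ E : Type*} [Countable ι] [Countable κ] [MeasurableSpace E]
    {X : ι × κ → Ω → E} (hX : ∀ p, AEMeasurable (X p) μ) (h : iIndepFun X μ) :
    iIndepFun (fun i ω k => X (i, k) ω) μ := by
  have := h.isProbabilityMeasure
  have hprob : ∀ i k, IsProbabilityMeasure (μ.map (X (i, k))) := fun i k =>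
    Measure.isProbabilityMeasure_map (hX (i, k))
  have hrow : ∀ i, AEMeasurable (fun ω k => X (i, k) ω) μ := fun i =>
    aemeasurable_pi_lambda _ fun k => hX (i, k)
  have hcurry : (fun ω i k => X (i, k) ω)
      = (MeasurableEquiv.curry ι κ E) ∘ (fun ω p => X p ω) := rfl
  rw [iIndepFun_iff_map_fun_eq_infinitePi_map₀' hrow, hcurry,
    ← AEMeasurable.map_map_of_aemeasurable (by fun_prop) (aemeasurable_pi_lambda _ hX),
    h.map_fun_eq_infinitePi_map₀' hX, Measure.infinitePi_map_curry (fun i k => μ.map (X (i, k)))]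
  congr with i : 1
  exact ((h.precomp (Prod.mk_right_injective i)).map_fun_eq_infinitePi_map₀'
    fun k => hX (i, k)).symm

lemma hasLaw_sum_gaussianReal {ι : Type*} [Fintype ι] {X : ι → Ω → ℝ} {m : ι → ℝ}
    {v : ι → NNReal} (hX : ∀ i, HasLaw (X i) (gaussianReal (m i) (v i)) μ)
    (hind : iIndepFun X μ) :
    HasLaw (fun ω => ∑ i, X i ω) (gaussianReal (∑ i, m i) (∑ i, v i)) μ := by
  have := hind.isProbabilityMeasure
  have hmeas : ∀ i, AEMeasurable (X i) μ := fun i => (hX i).aemeasurable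
  refine ⟨Finset.aemeasurable_fun_sum _ fun i _ => hmeas i, Measure.ext_of_charFun ?_⟩
  rw [hind.charFun_map_fun_sum_eq_prod hmeas]
  ext t
  simp only [Finset.prod_apply, (hX _).map_eq, charFun_gaussianReal, ← Complex.exp_sum,
    Finset.sum_sub_distrib, ← Finset.sum_mul, ← Finset.mul_sum, ← Finset.sum_div,
    Complex.ofReal_sum, NNReal.coe_sum]

lemma hasLaw_sum_mul_gaussianReal {ι : Type*} [Fintype ι] {X : ι → Ω → ℝ}
    (hX : ∀ i, HasLaw (X i) (gaussianReal 0 1) μ) (hind : iIndepFun X μ)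
    (a : EuclideanSpace ℝ ι) :
    HasLaw (fun ω => ∑ i, a i * X i ω) (gaussianReal 0 (‖a‖₊ ^ 2)) μ := by
  have hterm : ∀ i, HasLaw (fun ω => a i * X i ω) (gaussianReal 0 (‖a i‖₊ ^ 2)) μ := by
    intro i
    convert gaussianReal_const_mul (hX i) (a i) using 2
    · simp
    · ext; simp
  have hsum := hasLaw_sum_gaussianReal hterm
    (hind.comp (fun i x => a i * x) fun i => by fun_prop)
  have hvar : ∑ i, ‖a i‖₊ ^ 2 = ‖a‖₊ ^ 2 := by
    ext; simp [EuclideanSpace.norm_sq_eq]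
  rwa [Finset.sum_const_zero, hvar] at hsum

lemma integral_exp_mul_sq_gaussianReal {c : ℝ} (hc : c < 1 / 2) :
    ∫ x, Real.exp (c * x ^ 2) ∂(gaussianReal 0 1) = (√(1 - 2 * c))⁻¹ := by
  have hdensity : ∀ x, gaussianPDFReal 0 1 x * Real.exp (c * x ^ 2)
      = (√(2 * Real.pi))⁻¹ * Real.exp (-(1 / 2 - c) * x ^ 2) := fun x => by
    simp only [gaussianPDFReal, NNReal.coe_one, mul_one, sub_zero, mul_assoc, ← Real.exp_add]
    congr 2
    ring
  have : 1 / 2 - c ≠ 0 := by linarith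
  have : 1 - 2 * c ≠ 0 := by linarith
  rw [integral_gaussianReal_eq_integral_smul one_ne_zero]
  simp only [smul_eq_mul, hdensity]
  rw [integral_const_mul, integral_gaussian, ← Real.sqrt_inv, ← Real.sqrt_inv,
    ← Real.sqrt_mul (by positivity)]
  congr 1
  field_simp

lemma inv_sqrt_one_sub_two_mul_le_exp {c : ℝ} (hc : c ≤ 1 / 4) :
    (√(1 - 2 * c))⁻¹ ≤ Real.exp (c + 4 * c ^ 2) := by
  have hpos : 0 < 1 - 2 * c := by linarith
  have hinv : (1 - 2 * c)⁻¹ ≤ 1 + 2 * (c + 4 * c ^ 2) := by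
    rw [inv_le_iff_one_le_mul₀ hpos]
    nlinarith [mul_nonneg (sq_nonneg c) (show (0 : ℝ) ≤ 1 - 4 * c by linarith)]
  rw [← Real.exp_log (inv_pos.mpr (Real.sqrt_pos.mpr hpos)), Real.log_inv, Real.log_sqrt hpos.le]
  gcongr
  linarith [Real.one_sub_inv_le_log_of_pos hpos]

section ChiSquared

variable {ι : Type*} [Fintype ι] {X : ι → Ω → ℝ}

lemma mgf_sum_sq_gaussianReal (hX : ∀ i, HasLaw (X i) (gaussianReal 0 1) μ)
    (hind : iIndepFun X μ) {c : ℝ} (hc : c < 1 / 2) :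
    mgf (fun ω => ∑ i, X i ω ^ 2) μ c = (√(1 - 2 * c))⁻¹ ^ Fintype.card ι := by
  have hmgf : ∀ i, mgf (fun ω => X i ω ^ 2) μ c = (√(1 - 2 * c))⁻¹ := fun i => by
    rw [← integral_exp_mul_sq_gaussianReal hc]
    exact (hX i).integral_comp (f := fun x => Real.exp (c * x ^ 2)) (by fun_prop)
  have hsum : (fun ω => ∑ i, X i ω ^ 2) = ∑ i, fun ω => X i ω ^ 2 := by ext; simp
  have hind_sq : iIndepFun (fun i ω => X i ω ^ 2) μ :=
    hind.comp (fun _ x => x ^ 2) fun _ => by fun_prop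
  rw [hsum, hind_sq.mgf_sum₀ fun i => (hX i).aemeasurable.pow_const 2]
  simp only [hmgf, Finset.prod_const, Finset.card_univ]

lemma integrable_exp_mul_sum_sq_gaussianReal (hX : ∀ i, HasLaw (X i) (gaussianReal 0 1) μ)
    (hind : iIndepFun X μ) {c : ℝ} (hc : c < 1 / 2) :
    Integrable (fun ω => Real.exp (c * ∑ i, X i ω ^ 2)) μ := by
  refine Integrable.of_integral_ne_zero ?_
  have hpos : 0 < 1 - 2 * c := by linarith
  rw [← mgf, mgf_sum_sq_gaussianReal hX hind hc]
  positivity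

lemma mgf_sum_sq_gaussianReal_le (hX : ∀ i, HasLaw (X i) (gaussianReal 0 1) μ)
    (hind : iIndepFun X μ) {c : ℝ} (hc : c ≤ 1 / 4) :
    mgf (fun ω => ∑ i, X i ω ^ 2) μ c ≤ Real.exp (Fintype.card ι * (c + 4 * c ^ 2)) := by
  rw [mgf_sum_sq_gaussianReal hX hind (by linarith), Real.exp_nat_mul]
  gcongr
  exact inv_sqrt_one_sub_two_mul_le_exp hc

lemma measureReal_sum_sq_gaussianReal_ge_le (hX : ∀ i, HasLaw (X i) (gaussianReal 0 1) μ)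
    (hind : iIndepFun X μ) {t : ℝ} (ht₀ : 0 ≤ t) (ht₂ : t ≤ 2) :
    μ.real {ω | Fintype.card ι * (1 + t) ≤ ∑ i, X i ω ^ 2}
      ≤ Real.exp (-(Fintype.card ι * t ^ 2 / 16)) := by
  have := hind.isProbabilityMeasure
  -- `c = t / 8` minimises the exponent `-c * t + 4 * c ^ 2` of the Chernoff bound.
  calc μ.real {ω | Fintype.card ι * (1 + t) ≤ ∑ i, X i ω ^ 2}
      ≤ Real.exp (-(t / 8) * (Fintype.card ι * (1 + t)))
          * mgf (fun ω => ∑ i, X i ω ^ 2) μ (t / 8) :=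
        measure_ge_le_exp_mul_mgf _ (by linarith)
          (integrable_exp_mul_sum_sq_gaussianReal hX hind (by linarith))
    _ ≤ Real.exp (-(t / 8) * (Fintype.card ι * (1 + t)))
          * Real.exp (Fintype.card ι * (t / 8 + 4 * (t / 8) ^ 2)) := by
        gcongr
        exact mgf_sum_sq_gaussianReal_le hX hind (by linarith)
    _ = Real.exp (-(Fintype.card ι * t ^ 2 / 16)) := by
        rw [← Real.exp_add]
        congr 1
        ring

lemma measureReal_sum_sq_gaussianReal_le_le (hX : ∀ i, HasLaw (X i) (gaussianReal 0 1) μ)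
    (hind : iIndepFun X μ) {t : ℝ} (ht₀ : 0 ≤ t) :
    μ.real {ω | ∑ i, X i ω ^ 2 ≤ Fintype.card ι * (1 - t)}
      ≤ Real.exp (-(Fintype.card ι * t ^ 2 / 16)) := by
  have := hind.isProbabilityMeasure
  calc μ.real {ω | ∑ i, X i ω ^ 2 ≤ Fintype.card ι * (1 - t)}
      ≤ Real.exp (-(-(t / 8)) * (Fintype.card ι * (1 - t)))
          * mgf (fun ω => ∑ i, X i ω ^ 2) μ (-(t / 8)) :=
        measure_le_le_exp_mul_mgf _ (by linarith)
          (integrable_exp_mul_sum_sq_gaussianReal hX hind (by linarith))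
    _ ≤ Real.exp (-(-(t / 8)) * (Fintype.card ι * (1 - t)))
          * Real.exp (Fintype.card ι * (-(t / 8) + 4 * (-(t / 8)) ^ 2)) := by
        gcongr
        exact mgf_sum_sq_gaussianReal_le hX hind (by linarith)
    _ = Real.exp (-(Fintype.card ι * t ^ 2 / 16)) := by
        rw [← Real.exp_add]
        congr 1
        ring

lemma measureReal_abs_sum_sq_gaussianReal_sub_card_ge_le
    (hX : ∀ i, HasLaw (X i) (gaussianReal 0 1) μ) (hind : iIndepFun X μ) {t : ℝ}
    (ht₀ : 0 ≤ t) (ht₂ : t ≤ 2) :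
    μ.real {ω | Fintype.card ι * t ≤ |∑ i, X i ω ^ 2 - Fintype.card ι|}
      ≤ 2 * Real.exp (-(Fintype.card ι * t ^ 2 / 16)) := by
  have := hind.isProbabilityMeasure
  have hsub : {ω | Fintype.card ι * t ≤ |∑ i, X i ω ^ 2 - Fintype.card ι|} ⊆
      {ω | Fintype.card ι * (1 + t) ≤ ∑ i, X i ω ^ 2} ∪
        {ω | ∑ i, X i ω ^ 2 ≤ Fintype.card ι * (1 - t)} := by
    intro ω hω
    simp only [Set.mem_union, Set.mem_ofPred_eq, le_abs] at hω ⊢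
    exact hω.imp (fun h => by linarith) fun h => by linarith
  linarith [(measureReal_mono (μ := μ) hsub).trans (measureReal_union_le _ _),
    measureReal_sum_sq_gaussianReal_ge_le hX hind ht₀ ht₂,
    measureReal_sum_sq_gaussianReal_le_le hX hind ht₀]

end ChiSquared

lemma IsGaussianSketch.measureReal_abs_norm_sq_sub_card_ge_le {m n : Type*} [Fintype m]
    [DecidableEq m] [Fintype n] {Z : Ω → Matrix m n ℝ} (hZ : IsGaussianSketch Z μ)
    {a : EuclideanSpace ℝ m} (ha : ‖a‖ = 1) {t : ℝ} (ht₀ : 0 ≤ t) (ht₂ : t ≤ 2) :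
    μ.real {ω | Fintype.card n * t ≤ |‖Matrix.toEuclideanLin (Z ω)ᵀ a‖ ^ 2 - Fintype.card n|}
      ≤ 2 * Real.exp (-(Fintype.card n * t ^ 2 / 16)) := by
  have hlaw : ∀ s, HasLaw (fun ω => ∑ k, a k * Z ω k s) (gaussianReal 0 1) μ := fun s => by
    have h := hasLaw_sum_mul_gaussianReal (fun k => hZ.hasLaw k s)
      (hZ.indep.precomp (Prod.mk_left_injective s)) a
    rwa [show ‖a‖₊ = 1 from NNReal.eq ha, one_pow] at h
  have hcols : iIndepFun (fun s ω k => Z ω k s) μ :=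
    iIndepFun_curry (X := fun (p : n × m) ω => Z ω p.2 p.1)
      (fun p => (hZ.hasLaw p.2 p.1).aemeasurable) (hZ.indep.precomp Prod.swap_injective)
  have hnorm : ∀ ω, ‖Matrix.toEuclideanLin (Z ω)ᵀ a‖ ^ 2 = ∑ s, (∑ k, a k * Z ω k s) ^ 2 :=
    fun ω => by
      simp [EuclideanSpace.real_norm_sq_eq, Matrix.toLpLin_apply, Matrix.mulVec, dotProduct,
        mul_comm]
  simp only [hnorm]
  exact measureReal_abs_sum_sq_gaussianReal_sub_card_ge_le hlaw
    (hcols.comp (fun _ z => ∑ k, a k * z k) fun _ => by fun_prop) ht₀ ht₂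

end Gaussian

section Net

lemma packingNumber_half_le_of_subset_closedBall {E : Type*} [NormedAddCommGroup E]
    [NormedSpace ℝ E] [FiniteDimensional ℝ E] {A : Set E} (hA : A ⊆ Metric.closedBall 0 1) :
    Metric.packingNumber (1 / 2) A ≤ 5 ^ Module.finrank ℝ E := by
  classical
  refine iSup₂_le fun C hCA => iSup_le fun hsep => ?_
  by_contra! hcard
  obtain ⟨t, htC, htcard⟩ := Set.exists_subset_encard_eq (Order.add_one_le_of_lt hcard)
  have htfin : t.Finite := Set.finite_of_encard_eq_coe htcard
  lift t to Finset E using htfin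
  have hinj : Function.Injective fun y : E => (2 : ℝ) • y := smul_right_injective E two_ne_zero
  have hle : (t.image fun y : E => (2 : ℝ) • y).card ≤ 5 ^ Module.finrank ℝ E := by
    refine Besicovitch.card_le_of_separated _ ?_ ?_ <;> simp only [Finset.forall_mem_image]
    · intro y hy
      have : ‖y‖ ≤ 1 := mem_closedBall_zero_iff.mp (hA (hCA (htC hy)))
      rw [norm_smul, Real.norm_ofNat]
      linarith
    · intro y hy z hz hne
      have hdist : ((1 / 2 : NNReal) : ENNReal) < edist y z :=
        hsep (htC hy) (htC hz) fun h => hne (by rw [h])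
      rw [edist_nndist, ENNReal.coe_lt_coe, ← NNReal.coe_lt_coe, coe_nndist, dist_eq_norm] at hdist
      push_cast at hdist
      rw [← smul_sub, norm_smul, Real.norm_ofNat]
      linarith
  rw [Finset.card_image_of_injective t hinj] at hle
  rw [Set.encard_coe_eq_coe_finsetCard] at htcard
  norm_cast at htcard
  omega

lemma exists_finset_isCover_half {E : Type*} [NormedAddCommGroup E] [NormedSpace ℝ E]
    [FiniteDimensional ℝ E] {A : Set E} (hA : A ⊆ Metric.closedBall 0 1) :
    ∃ s : Finset E, ↑s ⊆ A ∧ Metric.IsCover (1 / 2) A s ∧ s.card ≤ 5 ^ Module.finrank ℝ E := by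
  have hcard : Metric.coveringNumber (1 / 2) A ≤ (5 ^ Module.finrank ℝ E : ℕ) := by
    exact_mod_cast (Metric.coveringNumber_le_packingNumber _ _).trans
      (packingNumber_half_le_of_subset_closedBall hA)
  obtain ⟨s, hsA, hsfin, hcover, hs⟩ :=
    Metric.exists_set_encard_eq_coveringNumber (ne_top_of_le_ne_top (ENat.natCast_ne_top _) hcard)
  lift s to Finset E using hsfin
  rw [← hs, Set.encard_coe_eq_coe_finsetCard] at hcard
  exact ⟨s, hsA, hcover, by exact_mod_cast hcard⟩

variable {𝕜 E : Type*} [RCLike 𝕜] [NormedAddCommGroup E] [InnerProductSpace 𝕜 E]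

lemma exists_hasEigenvalue_norm_eq_opNorm [FiniteDimensional 𝕜 E] [Nontrivial E] {T : E →L[𝕜] E}
    (hT : (T : E →ₗ[𝕜] E).IsSymmetric) :
    ∃ l : 𝕜, Module.End.HasEigenvalue (T : E →ₗ[𝕜] E) l ∧ ‖l‖ = ‖T‖ := by
  have := FiniteDimensional.complete 𝕜 E
  have hspec : spectrum 𝕜 T = spectrum 𝕜 (T : E →ₗ[𝕜] E) :=
    AlgEquiv.spectrum_eq (Module.End.toContinuousLinearMap E) (T : E →ₗ[𝕜] E)
  have hne : (spectrum 𝕜 T).Nonempty := by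
    rw [hspec]
    exact ⟨_, Module.End.hasEigenvalue_iff_mem_spectrum.mp
      hT.hasEigenvalue_iSup_of_finiteDimensional⟩
  obtain ⟨l, hl, hnorm⟩ := spectrum.exists_nnnorm_eq_spectralRadius_of_nonempty hne
  rw [ContinuousLinearMap.spectralRadius_eq_nnnorm T
    (ContinuousLinearMap.isSelfAdjoint_iff_isSymmetric.mpr hT), ENNReal.coe_inj] at hnorm
  rw [hspec, ← Module.End.hasEigenvalue_iff_mem_spectrum] at hl
  exact ⟨l, hl, congrArg NNReal.toReal hnorm⟩

lemma norm_inner_sub_eigenvalue_le {T : E →L[𝕜] E} (hT : (T : E →ₗ[𝕜] E).IsSymmetric) {l : 𝕜}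
    {x y : E} (hTx : T x = l • x) (hx : ‖x‖ = 1) (hy : ‖y‖ = 1) :
    ‖inner 𝕜 (T y) y - l‖ ≤ (‖T‖ + ‖l‖) * ‖y - x‖ ^ 2 := by
  have hl : starRingEnd 𝕜 l = l := by
    have hsymm : inner 𝕜 (T x) x = inner 𝕜 x (T x) := hT x x
    simpa [hTx, inner_smul_left, inner_smul_right, inner_self_eq_norm_sq_to_K, hx] using hsymm
  set R : E →L[𝕜] E := T - l • ContinuousLinearMap.id 𝕜 E
  have hRx : R x = 0 := by simp [R, hTx]
  have hRsymm : inner 𝕜 (R y) x = inner 𝕜 y (R x) :=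
    hT.sub (LinearMap.IsSymmetric.id.smul hl) y x
  have hR : ‖R‖ ≤ ‖T‖ + ‖l‖ := by
    calc ‖R‖ ≤ ‖T‖ + ‖l‖ * ‖ContinuousLinearMap.id 𝕜 E‖ :=
          (norm_sub_le _ _).trans_eq (by rw [norm_smul])
      _ ≤ ‖T‖ + ‖l‖ := by
          gcongr
          exact mul_le_of_le_one_right (norm_nonneg l) ContinuousLinearMap.norm_id_le
  -- The quadratic form of `R` has no first order term at `x`, because `R x = 0`.
  have hquad : inner 𝕜 (T y) y - l = inner 𝕜 (R (y - x)) (y - x) := by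
    rw [map_sub, hRx, sub_zero, inner_sub_right, hRsymm, hRx, inner_zero_right, sub_zero]
    simp [R, inner_sub_left, inner_smul_left, inner_self_eq_norm_sq_to_K, hy, hl]
  calc ‖inner 𝕜 (T y) y - l‖ ≤ ‖R (y - x)‖ * ‖y - x‖ := hquad ▸ norm_inner_le_norm _ _
    _ ≤ ‖R‖ * ‖y - x‖ * ‖y - x‖ := by gcongr; exact R.le_opNorm _
    _ = ‖R‖ * ‖y - x‖ ^ 2 := by ring
    _ ≤ (‖T‖ + ‖l‖) * ‖y - x‖ ^ 2 := by gcongr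

lemma opNorm_le_of_isCover_sphere [FiniteDimensional 𝕜 E] {T : E →L[𝕜] E}
    (hT : (T : E →ₗ[𝕜] E).IsSymmetric) {s : Set E} (hs : s ⊆ Metric.sphere 0 1)
    (hcover : Metric.IsCover (1 / 2) (Metric.sphere 0 1) s) {c : ℝ} (hc : 0 ≤ c)
    (hTs : ∀ y ∈ s, ‖inner 𝕜 (T y) y‖ ≤ c) : ‖T‖ ≤ 2 * c := by
  rcases subsingleton_or_nontrivial E with hE | hE
  · simpa [Subsingleton.elim T 0] using hc
  obtain ⟨l, hl, hnorm⟩ := exists_hasEigenvalue_norm_eq_opNorm hT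
  obtain ⟨x, hTx, hx⟩ : ∃ x, T x = l • x ∧ ‖x‖ = 1 := by
    obtain ⟨v, hv⟩ := hl.exists_hasEigenvector
    have hTv : T v = l • v := hv.apply_eq_smul
    exact ⟨(‖v‖⁻¹ : 𝕜) • v, by rw [map_smul, hTv, smul_comm], norm_smul_inv_norm hv.2⟩
  obtain ⟨y, hys, hxy⟩ := hcover (mem_sphere_zero_iff_norm.mpr hx)
  have hyx : ‖y - x‖ ≤ 1 / 2 := by
    have hedist : edist x y ≤ ((1 / 2 : NNReal) : ENNReal) := hxy
    rw [edist_nndist, ENNReal.coe_le_coe, ← NNReal.coe_le_coe, coe_nndist, dist_comm,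
      dist_eq_norm] at hedist
    exact_mod_cast hedist
  have hdiff : ‖inner 𝕜 (T y) y - l‖ ≤ (‖T‖ + ‖l‖) * (1 / 2) ^ 2 :=
    (norm_inner_sub_eigenvalue_le hT hTx hx (mem_sphere_zero_iff_norm.mp (hs hys))).trans
      (by gcongr)
  have hle : ‖l‖ ≤ ‖inner 𝕜 (T y) y‖ + ‖inner 𝕜 (T y) y - l‖ := norm_le_norm_add_norm_sub _ _
  linarith [hTs y hys]

end Net

section SubspaceEmbedding

/-- `A` is an `ε`-subspace embedding of `V`: it preserves the squared norms of the vectors of `V`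
up to a relative error `ε`. -/
def IsSubspaceEmbedding {E F : Type*} [NormedAddCommGroup E] [NormedSpace ℝ E]
    [NormedAddCommGroup F] [NormedSpace ℝ F] (ε : ℝ) (V : Submodule ℝ E) (A : E →ₗ[ℝ] F) : Prop :=
  ∀ x ∈ V, |‖A x‖ ^ 2 - ‖x‖ ^ 2| ≤ ε * ‖x‖ ^ 2

lemma isSubspaceEmbedding_of_isCover_sphere {E F : Type*} [NormedAddCommGroup E]
    [InnerProductSpace ℝ E] [NormedAddCommGroup F] [InnerProductSpace ℝ F] [CompleteSpace F]
    {V : Submodule ℝ E} [FiniteDimensional ℝ V] {A : E →ₗ[ℝ] F} {s : Set V}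
    (hs : s ⊆ Metric.sphere 0 1) (hcover : Metric.IsCover (1 / 2) (Metric.sphere 0 1) s) {ε : ℝ}
    (hε : 0 ≤ ε) (hA : ∀ y ∈ s, |‖A y‖ ^ 2 - 1| ≤ ε / 2) : IsSubspaceEmbedding ε V A := by
  let B : V →L[ℝ] F := LinearMap.toContinuousLinearMap (A ∘ₗ V.subtype)
  let T : V →L[ℝ] V := B.adjoint ∘L B - ContinuousLinearMap.id ℝ V
  have hT : (T : V →ₗ[ℝ] V).IsSymmetric :=
    (ContinuousLinearMap.isSelfAdjoint_iff_isSymmetric.mp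
      B.isPositive_adjoint_comp_self.isSelfAdjoint).sub LinearMap.IsSymmetric.id
  have hquad : ∀ y : V, inner ℝ (T y) y = ‖A y‖ ^ 2 - ‖y‖ ^ 2 := fun y => by
    simp [T, B, inner_sub_left, ContinuousLinearMap.adjoint_inner_left]
  have hnorm : ‖T‖ ≤ 2 * (ε / 2) := by
    refine opNorm_le_of_isCover_sphere hT hs hcover (by positivity) fun y hy => ?_
    rw [hquad, mem_sphere_zero_iff_norm.mp (hs hy), one_pow]
    exact hA y hy
  intro x hx
  have hbound := (norm_inner_le_norm (𝕜 := ℝ) (T ⟨x, hx⟩) ⟨x, hx⟩).trans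
    (mul_le_mul_of_nonneg_right (T.le_of_opNorm_le hnorm ⟨x, hx⟩) (norm_nonneg _))
  rw [hquad, Real.norm_eq_abs] at hbound
  calc |‖A x‖ ^ 2 - ‖x‖ ^ 2| ≤ 2 * (ε / 2) * ‖x‖ * ‖x‖ := hbound
    _ = ε * ‖x‖ ^ 2 := by ring

lemma isSubspaceEmbedding_inv_sqrt_smul_of_isCover_sphere {E F : Type*} [NormedAddCommGroup E]
    [InnerProductSpace ℝ E] [NormedAddCommGroup F] [InnerProductSpace ℝ F] [CompleteSpace F]
    {V : Submodule ℝ E} [FiniteDimensional ℝ V] {A : E →ₗ[ℝ] F} {s : Set V}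
    (hs : s ⊆ Metric.sphere 0 1) (hcover : Metric.IsCover (1 / 2) (Metric.sphere 0 1) s) {ε c : ℝ}
    (hε : 0 ≤ ε) (hc : 0 < c) (hA : ∀ y ∈ s, |‖A y‖ ^ 2 - c| ≤ c * (ε / 2)) :
    IsSubspaceEmbedding ε V ((√c)⁻¹ • A) := by
  refine isSubspaceEmbedding_of_isCover_sphere hs hcover hε fun y hy => ?_
  have hscale : ‖((√c)⁻¹ • A) y‖ ^ 2 - 1 = (‖A y‖ ^ 2 - c) / c := by
    rw [LinearMap.smul_apply, norm_smul, mul_pow, norm_inv, inv_pow, Real.norm_eq_abs, sq_abs,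
      Real.sq_sqrt hc.le]
    field_simp
  rw [hscale, abs_div, abs_of_pos hc, div_le_iff₀' hc]
  exact hA y hy

lemma IsGaussianSketch.measureReal_not_isSubspaceEmbedding_le {Ω : Type*} [MeasurableSpace Ω]
    {μ : Measure Ω} {m n : Type*} [Fintype m] [DecidableEq m] [Fintype n] {Z : Ω → Matrix m n ℝ}
    (hZ : IsGaussianSketch Z μ) (V : Submodule ℝ (EuclideanSpace ℝ m)) {ε : ℝ} (hε₀ : 0 ≤ ε)
    (hε₄ : ε ≤ 4) :
    μ.real {ω | ¬ IsSubspaceEmbedding ε V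
        (Matrix.toEuclideanLin ((√(Fintype.card n))⁻¹ • (Z ω)ᵀ))}
      ≤ 5 ^ Module.finrank ℝ V * (2 * Real.exp (-(Fintype.card n * ε ^ 2 / 64))) := by
  have := hZ.indep.isProbabilityMeasure
  rcases isEmpty_or_nonempty n with hn | hn
  · have hpow : (1 : ℝ) ≤ 5 ^ Module.finrank ℝ V := one_le_pow₀ (by norm_num)
    refine measureReal_le_one.trans ?_
    simp only [Fintype.card_eq_zero, Nat.cast_zero, zero_mul, zero_div, neg_zero, Real.exp_zero]
    linarith
  set c : ℝ := (Fintype.card n : ℝ)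
  have hc : 0 < c := Nat.cast_pos.mpr Fintype.card_pos
  obtain ⟨s, hs, hcover, hcard⟩ :=
    exists_finset_isCover_half (E := V) Metric.sphere_subset_closedBall
  let bad : V → Set Ω := fun y =>
    {ω | c * (ε / 2) ≤ |‖Matrix.toEuclideanLin (Z ω)ᵀ (y : EuclideanSpace ℝ m)‖ ^ 2 - c|}
  have hbad : ∀ y ∈ s, μ.real (bad y) ≤ 2 * Real.exp (-(c * ε ^ 2 / 64)) := fun y hy => by
    have hy : ‖(y : EuclideanSpace ℝ m)‖ = 1 := mem_sphere_zero_iff_norm.mp (hs hy)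
    convert hZ.measureReal_abs_norm_sq_sub_card_ge_le hy (t := ε / 2) (by linarith)
      (by linarith) using 4
    ring
  have hsub : {ω | ¬ IsSubspaceEmbedding ε V (Matrix.toEuclideanLin ((√c)⁻¹ • (Z ω)ᵀ))}
      ⊆ ⋃ y ∈ s, bad y := fun ω hω => by
    by_contra hgood
    refine hω ?_
    rw [map_smul]
    exact isSubspaceEmbedding_inv_sqrt_smul_of_isCover_sphere hs hcover hε₀ hc fun y hy =>
      (not_le.mp fun h => hgood (Set.mem_biUnion hy h)).le
  calc _ ≤ ∑ y ∈ s, μ.real (bad y) :=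
        (measureReal_mono hsub (measure_ne_top μ _)).trans (measureReal_biUnion_finset_le _ _)
    _ ≤ s.card * (2 * Real.exp (-(c * ε ^ 2 / 64))) := by
        simpa only [nsmul_eq_mul] using Finset.sum_le_card_nsmul _ _ _ hbad
    _ ≤ 5 ^ Module.finrank ℝ V * (2 * Real.exp (-(c * ε ^ 2 / 64))) := by
        gcongr
        exact_mod_cast hcard

end SubspaceEmbedding

section Log

lemma norm_le_of_mem_Icc_algebraMap {A : Type*} [NormedRing A] [StarRing A] [NormedAlgebra ℝ A]
    [IsometricContinuousFunctionalCalculus ℝ A IsSelfAdjoint] [PartialOrder A] [StarOrderedRing A]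
    [NonnegSpectrumClass ℝ A] {a : A} (ha : IsSelfAdjoint a) {c : ℝ} (hc : 0 ≤ c)
    (hac : a ∈ Set.Icc (algebraMap ℝ A (-c)) (algebraMap ℝ A c)) : ‖a‖ ≤ c := by
  rw [← cfc_id' ℝ a]
  exact norm_cfc_le hc fun x hx => abs_le.mpr
    ⟨(algebraMap_le_iff_le_spectrum ha).mp hac.1 x hx,
      (le_algebraMap_iff_spectrum_le ha).mp hac.2 x hx⟩

lemma log_one_add_le_neg_log_one_sub {x : ℝ} (hx : x ∈ Set.Ioo (-1 : ℝ) 1) :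
    Real.log (1 + x) ≤ -Real.log (1 - x) := by
  have h₁ : 0 < 1 + x := by linarith [hx.1]
  have h₂ : 0 < 1 - x := by linarith [hx.2]
  have hlog : Real.log ((1 + x) * (1 - x)) ≤ 0 :=
    Real.log_nonpos (by positivity) (by nlinarith [sq_nonneg x])
  rw [Real.log_mul h₁.ne' h₂.ne'] at hlog
  linarith

section

open scoped ComplexOrder

lemma posDef_mono {𝕜 n : Type*} [RCLike 𝕜] {A B : Matrix n n 𝕜} (hA : A.PosDef) (hAB : A ≤ B) :
    B.PosDef := by
  simpa only [add_sub_cancel] using hA.add_posSemidef (Matrix.le_iff.mp hAB)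

variable {n : Type*} [Fintype n] [DecidableEq n]

/-- The inclusion of real matrices into complex matrices. It transfers the operator monotonicity of
the logarithm, which Mathlib proves for complex C⋆-algebras, to real matrices. -/
noncomputable def complexify : Matrix n n ℝ →⋆ₐ[ℝ] Matrix n n ℂ where
  toAlgHom := (Algebra.ofId ℝ ℂ).mapMatrix
  map_star' A := by
    ext i j
    simp [Matrix.star_apply, Algebra.ofId_apply]

lemma complexify_apply (A : Matrix n n ℝ) : complexify A = A.map ((↑) : ℝ → ℂ) := rfl

lemma posSemidef_complexify {A : Matrix n n ℝ} : (complexify A).PosSemidef ↔ A.PosSemidef := by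
  refine ⟨fun h => .of_dotProduct_mulVec_nonneg ?_ fun x => ?_, fun h => ?_⟩
  · ext i j
    simpa [complexify_apply] using congr_fun₂ h.isHermitian i j
  · have hform : star (fun i => (x i : ℂ)) ⬝ᵥ complexify A *ᵥ (fun i => (x i : ℂ))
        = ((star x ⬝ᵥ A *ᵥ x : ℝ) : ℂ) := by
      simp [dotProduct, Matrix.mulVec, complexify_apply]
    exact_mod_cast hform ▸ h.dotProduct_mulVec_nonneg fun i => (x i : ℂ)
  · obtain ⟨B, rfl⟩ := CStarAlgebra.nonneg_iff_eq_star_mul_self.mp h.nonneg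
    rw [map_mul, map_star]
    exact Matrix.posSemidef_conjTranspose_mul_self _

lemma complexify_le_complexify {A B : Matrix n n ℝ} : complexify A ≤ complexify B ↔ A ≤ B := by
  rw [Matrix.le_iff, Matrix.le_iff, ← map_sub, posSemidef_complexify]

lemma posDef_complexify {A : Matrix n n ℝ} (hA : A.PosDef) : (complexify A).PosDef :=
  (posSemidef_complexify.mpr hA.posSemidef).posDef_iff_isUnit.mpr (hA.isUnit.map complexify)

lemma complexify_log {A : Matrix n n ℝ} (hA : A.PosDef) :
    complexify (CFC.log A) = CFC.log (complexify A) := by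
  have hcont : Continuous (complexify : Matrix n n ℝ → Matrix n n ℂ) :=
    LinearMap.continuous_of_finiteDimensional (complexify (n := n)).toAlgHom.toLinearMap
  have hlog : ContinuousOn Real.log (spectrum ℝ A) := fun x hx =>
    (Real.continuousAt_log
      (spectrum.ne_zero_of_mem_of_unit (a := hA.isUnit.unit) hx)).continuousWithinAt
  exact complexify.map_cfc Real.log A hlog hcont hA.isHermitian (posDef_complexify hA).isHermitian

lemma log_le_log {A B : Matrix n n ℝ} (hA : A.PosDef) (hAB : A ≤ B) :
    CFC.log A ≤ CFC.log B := by
  rw [← complexify_le_complexify, complexify_log hA, complexify_log (posDef_mono hA hAB)]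
  exact CFC.log_le_log (complexify_le_complexify.mpr hAB)
    (Matrix.isStrictlyPositive_iff_posDef.mpr (posDef_complexify hA))

end

lemma RelClose.norm_log_sub_log_le {n : Type*} [Fintype n] [DecidableEq n] {A B : Matrix n n ℝ}
    (hA : A.PosDef) {ε : ℝ} (hε : ε ∈ Set.Ico (0 : ℝ) 1) (h : RelClose ε A B) :
    ‖CFC.log B - CFC.log A‖ ≤ |Real.log (1 - ε)| := by
  obtain ⟨hε₀, hε₁⟩ := hε
  have hneg : Real.log (1 - ε) ≤ 0 := Real.log_nonpos (by linarith) (by linarith)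
  have hlow : ((1 - ε) • A).PosDef := hA.smul (by linarith)
  have hpos : IsStrictlyPositive A := Matrix.isStrictlyPositive_iff_posDef.mpr hA
  have hlog_ge : algebraMap ℝ _ (Real.log (1 - ε)) + CFC.log A ≤ CFC.log B := by
    rw [← CFC.log_smul' A (by linarith) hpos]
    exact log_le_log hlow h.1
  have hlog_le : CFC.log B ≤ algebraMap ℝ _ (Real.log (1 + ε)) + CFC.log A := by
    rw [← CFC.log_smul' A (by linarith) hpos]
    exact log_le_log (posDef_mono hlow h.1) h.2
  rw [abs_of_nonpos hneg]
  refine norm_le_of_mem_Icc_algebraMap (IsSelfAdjoint.log.sub IsSelfAdjoint.log) (by linarith)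
    ⟨?_, (sub_le_iff_le_add.mpr hlog_le).trans (algebraMap_mono _ ?_)⟩
  · rw [neg_neg]
    exact le_sub_iff_add_le.mpr hlog_ge
  · exact log_one_add_le_neg_log_one_sub ⟨by linarith, hε₁⟩

end Log

section Sketch

lemma relClose_of_abs_dotProduct_sub_le {n : Type*} [Fintype n] {A B : Matrix n n ℝ}
    (hA : A.IsSymm) (hB : B.IsSymm) {ε : ℝ}
    (h : ∀ v, |v ⬝ᵥ B *ᵥ v - v ⬝ᵥ A *ᵥ v| ≤ ε * (v ⬝ᵥ A *ᵥ v)) : RelClose ε A B := by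
  have hB : B.IsHermitian := hB
  have hsmul : ∀ c : ℝ, (c • A).IsHermitian := fun c => hA.smul c
  refine ⟨Matrix.le_iff.mpr (.of_dotProduct_mulVec_nonneg (hB.sub (hsmul _)) fun v => ?_),
    Matrix.le_iff.mpr (.of_dotProduct_mulVec_nonneg ((hsmul _).sub hB) fun v => ?_)⟩ <;>
  · simp only [star_trivial, Matrix.sub_mulVec, dotProduct_sub, Matrix.smul_mulVec,
      dotProduct_smul, smul_eq_mul]
    linarith [abs_le.mp (h v)]

lemma dotProduct_transpose_mul_self_mulVec {m n : Type*} [Fintype m] [Fintype n] [DecidableEq n]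
    (M : Matrix m n ℝ) (v : n → ℝ) :
    v ⬝ᵥ (Mᵀ * M) *ᵥ v = ‖Matrix.toEuclideanLin M (WithLp.toLp 2 v)‖ ^ 2 := by
  rw [← Matrix.mulVec_mulVec, Matrix.dotProduct_mulVec, Matrix.vecMul_transpose,
    EuclideanSpace.real_norm_sq_eq]
  simp [Matrix.toLpLin_apply, dotProduct, sq]

lemma IsSubspaceEmbedding.relClose_transpose_mul_self {l m n : Type*} [Fintype l] [Fintype m]
    [DecidableEq m] [Fintype n] [DecidableEq n] {A : Matrix l m ℝ} {W : Matrix m n ℝ} {ε : ℝ}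
    (h : IsSubspaceEmbedding ε (LinearMap.range (Matrix.toEuclideanLin W))
      (Matrix.toEuclideanLin A)) :
    RelClose ε (Wᵀ * W) ((A * W)ᵀ * (A * W)) := by
  refine relClose_of_abs_dotProduct_sub_le (by simp [Matrix.IsSymm]) (by simp [Matrix.IsSymm])
    fun v => ?_
  rw [dotProduct_transpose_mul_self_mulVec, dotProduct_transpose_mul_self_mulVec,
    Matrix.toLpLin_mul_same]
  exact h _ (LinearMap.mem_range_self _ _)

variable {N S : ℕ} {K : Fin N → ℕ}

lemma posDef_primal (β : ℝ) {cost : Matrix (Idx K) (Idx K) ℝ}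
    {Lam : (i : Fin N) → Matrix (Fin (K i)) (Fin (K i)) ℝ} (hcost : cost.IsSymm)
    (hLam : ∀ i, (Lam i).IsSymm) : (primal β cost Lam).PosDef := by
  have hsymm : (effCost cost Lam).IsSymm := by
    rw [Matrix.IsSymm, effCost, Matrix.transpose_sub, Matrix.blockDiagonal'_transpose, hcost.eq]
    simp only [(hLam _).eq]
  have hsa : IsSelfAdjoint (-β • effCost cost Lam) :=
    (IsSelfAdjoint.all (-β)).smul hsymm
  exact (Matrix.nonneg_iff_posSemidef.mp hsa.exp_nonneg).posDef_iff_isUnit.mpr (Matrix.isUnit_exp _)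

/-- The columns of the square root of `X` that belong to the block `i`. Diagonal blocks of `X` and
of its sketch are Gram matrices built from them. -/
noncomputable def sqrtCols (X : Matrix (Idx K) (Idx K) ℝ) (i : Fin N) :
    Matrix (Idx K) (Fin (K i)) ℝ :=
  (CFC.sqrt X).submatrix id fun k => ⟨i, k⟩

open scoped Classical in
lemma transpose_sqrt {n : Type*} [Fintype n] (X : Matrix n n ℝ) :
    (CFC.sqrt X)ᵀ = CFC.sqrt X :=
  (Matrix.nonneg_iff_posSemidef.mp (CFC.sqrt_nonneg X)).isHermitian

lemma blockDiag'_eq_sqrtCols {X : Matrix (Idx K) (Idx K) ℝ} (hX : X.PosSemidef) (i : Fin N) :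
    X.blockDiag' i = (sqrtCols X i)ᵀ * sqrtCols X i := by
  have hsqrt : X = (CFC.sqrt X)ᵀ * CFC.sqrt X := by
    rw [transpose_sqrt, CFC.sqrt_mul_sqrt_self X hX.nonneg]
  ext k l
  exact congr_fun₂ hsqrt ⟨i, k⟩ ⟨i, l⟩

lemma blockDiag'_sketch_eq_sqrtCols (X : Matrix (Idx K) (Idx K) ℝ) (Z : Matrix (Idx K) (Fin S) ℝ)
    (i : Fin N) :
    (sketch X Z).blockDiag' i
      = ((√S)⁻¹ • Zᵀ * sqrtCols X i)ᵀ * ((√S)⁻¹ • Zᵀ * sqrtCols X i) := by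
  have hgram : sketch X Z = ((√S)⁻¹ • Zᵀ * CFC.sqrt X)ᵀ * ((√S)⁻¹ • Zᵀ * CFC.sqrt X) := by
    simp only [sketch, Matrix.transpose_mul, Matrix.transpose_smul, Matrix.transpose_transpose,
      transpose_sqrt, Matrix.smul_mul, Matrix.mul_smul, smul_smul, Matrix.mul_assoc,
      ← mul_inv, Real.mul_self_sqrt (Nat.cast_nonneg S), one_div]
  ext k l
  exact congr_fun₂ hgram ⟨i, k⟩ ⟨i, l⟩

lemma IsGaussianSketch.measureReal_not_relClose_blockDiag'_le {Ω : Type*} [MeasurableSpace Ω]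
    {μ : Measure Ω} {Z : Ω → Matrix (Idx K) (Fin S) ℝ} (hZ : IsGaussianSketch Z μ)
    {X : Matrix (Idx K) (Idx K) ℝ} (hX : X.PosSemidef) {ε : ℝ} (hε₀ : 0 ≤ ε) (hε₄ : ε ≤ 4)
    (i : Fin N) :
    μ.real {ω | ¬ RelClose ε (X.blockDiag' i) ((sketch X (Z ω)).blockDiag' i)}
      ≤ 5 ^ K i * (2 * Real.exp (-(S * ε ^ 2 / 64))) := by
  have := hZ.indep.isProbabilityMeasure
  set V := LinearMap.range (Matrix.toEuclideanLin (sqrtCols X i))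
  have hdim : Module.finrank ℝ V ≤ K i := by
    simpa only [finrank_euclideanSpace, Fintype.card_fin]
      using LinearMap.finrank_range_le (Matrix.toEuclideanLin (sqrtCols X i))
  have hsub : {ω | ¬ RelClose ε (X.blockDiag' i) ((sketch X (Z ω)).blockDiag' i)} ⊆
      {ω | ¬ IsSubspaceEmbedding ε V (Matrix.toEuclideanLin ((√S)⁻¹ • (Z ω)ᵀ))} := by
    refine fun ω => mt fun hω => ?_
    rw [blockDiag'_eq_sqrtCols hX, blockDiag'_sketch_eq_sqrtCols]
    exact hω.relClose_transpose_mul_self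
  have hembed := hZ.measureReal_not_isSubspaceEmbedding_le V hε₀ hε₄
  rw [Fintype.card_fin] at hembed
  calc _ ≤ 5 ^ Module.finrank ℝ V * (2 * Real.exp (-(S * ε ^ 2 / 64))) :=
        (measureReal_mono hsub (measure_ne_top μ _)).trans hembed
    _ ≤ 5 ^ K i * (2 * Real.exp (-(S * ε ^ 2 / 64))) := by gcongr; norm_num

lemma IsGaussianSketch.measureReal_forall_relClose_blockDiag'_ge {Ω : Type*} [MeasurableSpace Ω]
    {μ : Measure Ω} {Z : Ω → Matrix (Idx K) (Fin S) ℝ} (hZ : IsGaussianSketch Z μ)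
    {X : Matrix (Idx K) (Idx K) ℝ} (hX : X.PosSemidef) {ε : ℝ} (hε₀ : 0 ≤ ε) (hε₄ : ε ≤ 4) :
    1 - N * (5 ^ maxBlock K * (2 * Real.exp (-(S * ε ^ 2 / 64)))) ≤
      μ.real {ω | ∀ i, RelClose ε (X.blockDiag' i) ((sketch X (Z ω)).blockDiag' i)} := by
  have := hZ.indep.isProbabilityMeasure
  set good := {ω | ∀ i, RelClose ε (X.blockDiag' i) ((sketch X (Z ω)).blockDiag' i)}
  have hcompl : goodᶜ =
      ⋃ i, {ω | ¬ RelClose ε (X.blockDiag' i) ((sketch X (Z ω)).blockDiag' i)} := by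
    ext ω; simp [good]
  have hbad : μ.real goodᶜ ≤ N * (5 ^ maxBlock K * (2 * Real.exp (-(S * ε ^ 2 / 64)))) := by
    calc μ.real goodᶜ ≤ ∑ i, 5 ^ K i * (2 * Real.exp (-(S * ε ^ 2 / 64))) := by
          rw [hcompl]
          exact (measureReal_iUnion_fintype_le _).trans <| Finset.sum_le_sum fun i _ =>
            hZ.measureReal_not_relClose_blockDiag'_le hX hε₀ hε₄ i
      _ ≤ ∑ _i : Fin N, 5 ^ maxBlock K * (2 * Real.exp (-(S * ε ^ 2 / 64))) := by
          gcongr with i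
          · norm_num
          · exact Finset.le_sup (f := K) (Finset.mem_univ i)
      _ = N * (5 ^ maxBlock K * (2 * Real.exp (-(S * ε ^ 2 / 64)))) := by
          simp only [Finset.sum_const, Finset.card_univ, Fintype.card_fin, nsmul_eq_mul]
  have hunion := measureReal_union_le (μ := μ) good goodᶜ
  rw [Set.union_compl_self, probReal_univ] at hunion
  linarith

end Sketch

section SampleSize

lemma union_bound_le_of_sample_size_le {ε δ : ℝ} (hε : 0 < ε) (hδ : 0 < δ) {N d S : ℕ}
    (hS : 64 * (Real.log (2 * N / δ) + d * Real.log 5) / ε ^ 2 ≤ S) :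
    N * (5 ^ d * (2 * Real.exp (-(S * ε ^ 2 / 64)))) ≤ δ := by
  rcases N.eq_zero_or_pos with rfl | hN
  · simpa using hδ.le
  have hexp : Real.log (2 * N / δ) + d * Real.log 5 ≤ S * ε ^ 2 / 64 := by
    rw [div_le_iff₀ (by positivity)] at hS
    linarith
  have hprod : Real.exp (Real.log (2 * N / δ) + d * Real.log 5) = 2 * N / δ * 5 ^ d := by
    rw [Real.exp_add, Real.exp_log (by positivity), Real.exp_nat_mul, Real.exp_log (by norm_num)]
  calc N * (5 ^ d * (2 * Real.exp (-(S * ε ^ 2 / 64))))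
      = δ * (2 * N / δ * 5 ^ d * Real.exp (-(S * ε ^ 2 / 64))) := by field_simp
    _ ≤ δ * (Real.exp (S * ε ^ 2 / 64) * Real.exp (-(S * ε ^ 2 / 64))) := by
        rw [← hprod]
        gcongr
    _ = δ := by rw [← Real.exp_add, add_neg_cancel, Real.exp_zero, mul_one]

lemma min_log_two_neg_log_le_log_div {δ₀ δ : ℝ} (hδ : δ ∈ Set.Ioc (0 : ℝ) 1) {N : ℕ} (hN : 1 ≤ N)
    (h : 2 ≤ N ∨ δ ≤ δ₀) : min (Real.log 2) (-Real.log δ₀) ≤ Real.log (N / δ) := by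
  have hN' : (1 : ℝ) ≤ N := by exact_mod_cast hN
  rw [Real.log_div (by positivity) hδ.1.ne']
  rcases h with h | h
  · have hlogN : Real.log 2 ≤ Real.log N := Real.log_le_log two_pos (by exact_mod_cast h)
    exact (min_le_left _ _).trans (by linarith [Real.log_nonpos hδ.1.le hδ.2])
  · exact (min_le_right _ _).trans (by linarith [Real.log_le_log hδ.1 h, Real.log_nonneg hN'])

lemma log_two_add_add_mul_log_five_le {c ℓ : ℝ} (hc : 0 < c) (hcℓ : c ≤ ℓ) {K : ℝ} (hK : 2 ≤ K) :
    Real.log 2 + ℓ + K * Real.log 5 ≤ (1 + 10 / c) * ℓ * (K * Real.log K) := by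
  have hlog2 : Real.log 2 ≤ 1 := by linarith [Real.log_le_sub_one_of_pos (x := 2) (by norm_num)]
  have hlog5 : Real.log 5 ≤ 4 := by linarith [Real.log_le_sub_one_of_pos (x := 5) (by norm_num)]
  have hlogK : 1 / 2 ≤ Real.log K := by
    linarith [Real.log_two_gt_d9, Real.log_le_log two_pos hK]
  have hQ : K / 2 ≤ K * Real.log K := by nlinarith
  have hKlog5 : K * Real.log 5 ≤ K * 4 := by gcongr
  have hℓ : ℓ ≤ ℓ * (K * Real.log K) := le_mul_of_one_le_right (hc.le.trans hcℓ) (by linarith)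
  have hten : 10 * (K * Real.log K) ≤ 10 / c * ℓ * (K * Real.log K) := by
    have : 10 ≤ 10 / c * ℓ := by
      rw [div_mul_eq_mul_div, le_div_iff₀ hc]
      linarith
    gcongr
  linarith

lemma sample_size_le_of_le_log_div {c ε δ : ℝ} (hc : 0 < c) (hδ : 0 < δ) {N : ℕ} (hN : 1 ≤ N)
    (hlog : c ≤ Real.log (N / δ)) {K : ℝ} (hK : 2 ≤ K) :
    64 * (Real.log (2 * N / δ) + K * Real.log 5) / ε ^ 2
      ≤ 64 * (1 + 10 / c) * Real.log (N / δ) / ε ^ 2 * (K * Real.log K) := by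
  have hNδ : (N : ℝ) / δ ≠ 0 := by positivity
  rw [mul_div_assoc 2, Real.log_mul two_ne_zero hNδ]
  calc _ ≤ 64 * ((1 + 10 / c) * Real.log (N / δ) * (K * Real.log K)) / ε ^ 2 := by
        gcongr
        exact log_two_add_add_mul_log_five_le hc hlog hK
    _ = _ := by ring

lemma exists_sample_size_constant {δ₀ : ℝ} (hδ₀ : δ₀ ∈ Set.Ioo (0 : ℝ) 1) :
    ∃ C : ℝ, 0 < C ∧ ∀ {ε δ : ℝ} {N d : ℕ}, δ ∈ Set.Ioc (0 : ℝ) 1 → 1 ≤ N →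
      2 ≤ N ∨ δ ≤ δ₀ → 2 ≤ d →
      64 * (Real.log (2 * N / δ) + d * Real.log 5) / ε ^ 2
        ≤ C * Real.log (N / δ) / ε ^ 2 * (d * Real.log d) := by
  set c := min (Real.log 2) (-Real.log δ₀)
  have hc : 0 < c := lt_min (Real.log_pos one_lt_two) (neg_pos.mpr (Real.log_neg hδ₀.1 hδ₀.2))
  exact ⟨64 * (1 + 10 / c), by positivity, fun hδ hN h hd => sample_size_le_of_le_log_div hc hδ.1 hN
    (min_log_two_neg_log_le_log_div hδ hN h) (by exact_mod_cast hd)⟩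

lemma pos_of_maxBlock_pos {N : ℕ} {K : Fin N → ℕ} (h : 0 < maxBlock K) : 0 < N :=
  have ⟨i, _⟩ := Finset.lt_sup_iff.mp h
  i.pos

end SampleSize

end BlockSketch

open BlockSketch in
theorem mainTheorem3_general {ε δ : ℝ} (hε : ε ∈ Set.Ioo (0 : ℝ) 1) (hδ : 0 < δ) {N : ℕ}
    {K : Fin N → ℕ} {S : ℕ}
    (hS : 64 * (Real.log (2 * N / δ) + maxBlock K * Real.log 5) / ε ^ 2 ≤ S)
    {Ω : Type*} [MeasurableSpace Ω] {μ : Measure Ω} {Z : Ω → Matrix (Idx K) (Fin S) ℝ}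
    (hZ : IsGaussianSketch Z μ) {X : Matrix (Idx K) (Idx K) ℝ} (hX : X.PosDef) :
    1 - δ ≤ μ.real {ω | ∀ i,
        RelClose ε (X.blockDiag' i) ((sketch X (Z ω)).blockDiag' i) ∧
        ‖CFC.log ((sketch X (Z ω)).blockDiag' i) - CFC.log (X.blockDiag' i)‖
          ≤ |Real.log (1 - ε)|} ∧
      ∀ ω i, RelClose ε (X.blockDiag' i) ((sketch X (Z ω)).blockDiag' i) →
        ‖CFC.log ((sketch X (Z ω)).blockDiag' i) - CFC.log (X.blockDiag' i)‖
          ≤ |Real.log (1 - ε)| := by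
  have hlog : ∀ ω i, RelClose ε (X.blockDiag' i) ((sketch X (Z ω)).blockDiag' i) →
      ‖CFC.log ((sketch X (Z ω)).blockDiag' i) - CFC.log (X.blockDiag' i)‖
        ≤ |Real.log (1 - ε)| := fun _ i h =>
    h.norm_log_sub_log_le (hX.submatrix (sigma_mk_injective (i := i))) ⟨hε.1.le, hε.2⟩
  refine ⟨?_, hlog⟩
  have hprob := hZ.measureReal_forall_relClose_blockDiag'_ge hX.posSemidef hε.1.le
    (by linarith [hε.2])
  have hiff : ∀ ω, (∀ i, RelClose ε (X.blockDiag' i) ((sketch X (Z ω)).blockDiag' i) ∧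
      ‖CFC.log ((sketch X (Z ω)).blockDiag' i) - CFC.log (X.blockDiag' i)‖ ≤ |Real.log (1 - ε)|) ↔
      ∀ i, RelClose ε (X.blockDiag' i) ((sketch X (Z ω)).blockDiag' i) :=
    fun ω => forall_congr' fun i => and_iff_left_of_imp (hlog ω i)
  simp only [hiff]
  linarith [union_bound_le_of_sample_size_le hε.1 hδ hS]

theorem mainTheorem3 (δ₀ : ℝ) (hδ₀ : δ₀ ∈ Set.Ioo (0 : ℝ) 1) :
    ∃ C : ℝ, 0 < C ∧
      ∀ (ε δ : ℝ), ε ∈ Set.Ioo (0 : ℝ) 1 → δ ∈ Set.Ioo (0 : ℝ) 1 →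
      ∀ (N : ℕ) (K : Fin N → ℕ),
        (2 ≤ N ∨ δ ≤ δ₀) → 2 ≤ BlockSketch.maxBlock K →
      ∀ (β : ℝ), 0 < β →
      ∀ (cost : Matrix (BlockSketch.Idx K) (BlockSketch.Idx K) ℝ)
        (Lam : (i : Fin N) → Matrix (Fin (K i)) (Fin (K i)) ℝ),
        cost.IsSymm → (∀ i, (Lam i).IsSymm) →
      ∀ (S : ℕ),
        C * Real.log (N / δ) / ε ^ 2 *
          (BlockSketch.maxBlock K * Real.log (BlockSketch.maxBlock K)) ≤ S →
      ∀ {Ω : Type*} [MeasurableSpace Ω] (μ : Measure Ω) [IsProbabilityMeasure μ]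
        (Z : Ω → Matrix (BlockSketch.Idx K) (Fin S) ℝ), BlockSketch.IsGaussianSketch Z μ →
      ∀ (X : Matrix (BlockSketch.Idx K) (BlockSketch.Idx K) ℝ)
        (Xhat : Ω → Matrix (BlockSketch.Idx K) (BlockSketch.Idx K) ℝ),
        X = BlockSketch.primal β cost Lam → (∀ ω, Xhat ω = BlockSketch.sketch X (Z ω)) →
      1 - δ ≤ μ.real {ω | ∀ i,
          BlockSketch.RelClose ε (X.blockDiag' i) ((Xhat ω).blockDiag' i) ∧
          ‖CFC.log ((Xhat ω).blockDiag' i) - CFC.log (X.blockDiag' i)‖ ≤ |Real.log (1 - ε)|} ∧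
      ∀ ω i, BlockSketch.RelClose ε (X.blockDiag' i) ((Xhat ω).blockDiag' i) →
          ‖CFC.log ((Xhat ω).blockDiag' i) - CFC.log (X.blockDiag' i)‖ ≤ |Real.log (1 - ε)| := by
  obtain ⟨C, hC, hsize⟩ := BlockSketch.exists_sample_size_constant hδ₀
  refine ⟨C, hC, ?_⟩
  rintro ε δ hε hδ N K hNδ hK β - cost Lam hcost hLam S hS Ω _ μ _ Z hZ X Xhat rfl hXhat
  obtain rfl : Xhat = fun ω => BlockSketch.sketch _ (Z ω) := funext hXhat
  have hN : 0 < N := BlockSketch.pos_of_maxBlock_pos (two_pos.trans_le hK)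
  exact mainTheorem3_general hε hδ.1 ((hsize ⟨hδ.1, hδ.2.le⟩ hN hNδ hK).trans hS) hZ
    (BlockSketch.posDef_primal β hcost hLam)
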